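/- Let $\mathcal{E}$ be an elementary topos, that is, a category with finite limits in which every object $X$ has a power object $\mathcal{P}(X)$, and let $f:P\to Q$ and $h:H\to P$ be arrows of $\mathcal{E}$. Write $\prod_f:\mathcal{E}/P\to\mathcal{E}/Q$ for the dependent product along $f$, i.e. the right adjoint of the pullback functor $f^*:\mathcal{E}/Q\to\mathcal{E}/P$. This right adjoint exists, and its value $\prod_f[h]$ at the object $h:H\to P$ of $\mathcal{E}/P$ is, up to isomorphism in $\mathcal{E}/Q$, the subobject of $Q\times\mathcal{P}(H\times P)$ defined by the following formula of the internal language of $\mathcal{E}$, $$\{(q,w)\in Q\times\mathcal{P}(H\times P)\mid \forall p\in P\,\bigl(f(p)=q\Rightarrow\exists!\,x\in H\,((x,p)\in w)\bigr)\ \wedge\ \forall p\in P\,\forall x\in H\,\bigl((x,p)\in w\Rightarrow h(x)=p\wedge f(p)=q\bigr)\},$$ with structure morphism to $Q$ the restriction of the projection $Q\times\mathcal{P}(H\times P)\to Q$. -/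

import Mathlib

open CategoryTheory Limits

universe v u

namespace ToposLogic

/-- A power object of `X` in a category with finite limits: an object `pow` with a subobject
`mem` (the membership relation `∈_X`) of `X ⨯ pow` such that every subobject `N` of `X ⨯ Y` is
the pullback of `mem` along `𝟙 ⨯ g` for exactly one `g : Y ⟶ pow`. -/
structure PowerObject {C : Type u} [Category.{v} C] [HasFiniteLimits C] (X : C) where
  /-- The object of subobjects of `X`. -/
  pow : C
  /-- The membership relation. -/
  mem : Subobject (X ⨯ pow)
  existsUnique_classify : ∀ {Y : C} (N : Subobject (X ⨯ Y)),
    ∃! g : Y ⟶ pow, (Subobject.pullback (prod.map (𝟙 X) g)).obj mem = N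

/-- The classifying arrow `y ↦ {x | (x, y) ∈ N}` of a subobject `N` of `X ⨯ Y`. -/
noncomputable def PowerObject.classify {C : Type u} [Category.{v} C] [HasFiniteLimits C] {X : C}
    (W : PowerObject X) {Y : C} (N : Subobject (X ⨯ Y)) : Y ⟶ W.pow :=
  (W.existsUnique_classify N).choose

/-- An elementary topos: a category with finite limits in which every object has a power
object. -/
class ElementaryTopos (C : Type u) [Category.{v} C] [HasFiniteLimits C] : Prop where
  nonempty_powerObject : ∀ X : C, Nonempty (PowerObject X)

/-! ### Syntax of the internal language

The types are the objects of `C`, a context is the list of the types of its variables, and every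
arrow of `C` is a function symbol. -/

/-- The variables of type `X` in a context (de Bruijn indices). -/
inductive Var {C : Type u} : List C → C → Type u
  | zero {Γ : List C} {X : C} : Var (X :: Γ) X
  | succ {Γ : List C} {X Y : C} : Var Γ X → Var (Y :: Γ) X

/-- The terms of type `X` in a context. -/
inductive Term {C : Type u} [Category.{v} C] [HasFiniteLimits C] : List C → C → Type (max u v)
  | var {Γ : List C} {X : C} : Var Γ X → Term Γ X
  | app {Γ : List C} {X Y : C} (f : X ⟶ Y) : Term Γ X → Term Γ Y
  | pair {Γ : List C} {X Y : C} : Term Γ X → Term Γ Y → Term Γ (X ⨯ Y)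

/-- The formulas in a context, built from equality and membership by conjunction, implication
and the quantifiers; a quantifier binds the first variable of the context. -/
inductive Formula {C : Type u} [Category.{v} C] [HasFiniteLimits C] : List C → Type (max u v)
  | eq {Γ : List C} {X : C} : Term Γ X → Term Γ X → Formula Γ
  | mem {Γ : List C} {X : C} (W : PowerObject X) : Term Γ X → Term Γ W.pow → Formula Γ
  | and {Γ : List C} : Formula Γ → Formula Γ → Formula Γ
  | imp {Γ : List C} : Formula Γ → Formula Γ → Formula Γ
  | all {Γ : List C} (X : C) : Formula (X :: Γ) → Formula Γ
  | ex {Γ : List C} (X : C) : Formula (X :: Γ) → Formula Γ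

/-- Extension of a renaming of variables under a binder. -/
def liftRenaming {C : Type u} {Γ Δ : List C} (ρ : ∀ X : C, Var Γ X → Var Δ X) (Y : C) :
    ∀ X : C, Var (Y :: Γ) X → Var (Y :: Δ) X
  | _, .zero => .zero
  | X, .succ i => .succ (ρ X i)

/-- Renaming of variables in a term. -/
def Term.rename {C : Type u} [Category.{v} C] [HasFiniteLimits C] {Γ Δ : List C}
    (ρ : ∀ X : C, Var Γ X → Var Δ X) : ∀ {X : C}, Term Γ X → Term Δ X
  | _, .var i => .var (ρ _ i)
  | _, .app f t => .app f (t.rename ρ)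
  | _, .pair s t => .pair (s.rename ρ) (t.rename ρ)

/-- Renaming of variables in a formula. -/
def Formula.rename {C : Type u} [Category.{v} C] [HasFiniteLimits C] : ∀ {Γ Δ : List C},
    (∀ X : C, Var Γ X → Var Δ X) → Formula Γ → Formula Δ
  | _, _, ρ, .eq s t => .eq (s.rename ρ) (t.rename ρ)
  | _, _, ρ, .mem W s t => .mem W (s.rename ρ) (t.rename ρ)
  | _, _, ρ, .and φ ψ => .and (φ.rename ρ) (ψ.rename ρ)
  | _, _, ρ, .imp φ ψ => .imp (φ.rename ρ) (ψ.rename ρ)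
  | _, _, ρ, .all X φ => .all X (φ.rename (liftRenaming ρ X))
  | _, _, ρ, .ex X φ => .ex X (φ.rename (liftRenaming ρ X))

/-- `∃! x, φ x`, as an abbreviation for `∃ x, (φ x ∧ ∀ x', (φ x' ⇒ x' = x))`. -/
def Formula.exUnique {C : Type u} [Category.{v} C] [HasFiniteLimits C] {Γ : List C} (X : C)
    (φ : Formula (X :: Γ)) : Formula Γ :=
  .ex X (.and φ (.all X (.imp (φ.rename (liftRenaming (fun _ i => .succ i) X))
    (.eq (.var .zero) (.var (.succ .zero))))))

/-! ### Interpretation in a topos -/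

section Interpretation

variable {C : Type u} [Category.{v} C] [HasFiniteLimits C]

/-- The interpretation of a context as the product of its types. -/
noncomputable def ctxObj : List C → C
  | [] => ⊤_ C
  | X :: Γ => X ⨯ ctxObj Γ

/-- The interpretation of a variable as a product projection. -/
noncomputable def Var.interp : ∀ {Γ : List C} {X : C}, Var Γ X → (ctxObj Γ ⟶ X)
  | _, _, .zero => prod.fst
  | _, _, .succ i => prod.snd ≫ i.interp

/-- The interpretation of a term as an arrow. -/
noncomputable def Term.interp {Γ : List C} : ∀ {X : C}, Term Γ X → (ctxObj Γ ⟶ X)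
  | _, .var i => i.interp
  | _, .app f t => t.interp ≫ f
  | _, .pair s t => prod.lift s.interp t.interp

variable [ElementaryTopos C]

/-- A choice of power objects, used to interpret implication and the quantifiers. -/
noncomputable def powerObject (X : C) : PowerObject X :=
  (ElementaryTopos.nonempty_powerObject X).some

/-- The characteristic arrow, with values in `Ω = 𝒫(1)`, of a subobject. -/
noncomputable def char {Y : C} (A : Subobject Y) : Y ⟶ (powerObject (⊤_ C)).pow :=
  (powerObject (⊤_ C)).classify ((Subobject.pullback prod.snd).obj A)

/-- The subobject `true` of `Ω = 𝒫(1)`. -/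
noncomputable def truth : Subobject (powerObject (⊤_ C)).pow :=
  (Subobject.pullback (prod.lift (terminal.from _) (𝟙 _))).obj (powerObject (⊤_ C)).mem

/-- Implication: the locus where the truth values of `A ⊓ B` and `A` agree. -/
noncomputable def subImp {Y : C} (A B : Subobject Y) : Subobject Y :=
  equalizerSubobject (char (A ⊓ B)) (char A)

/-- Universal quantification: the locus of the `y` with `{x | (x, y) ∈ A} = {x | ⊤}`. -/
noncomputable def subAll {X Y : C} (A : Subobject (X ⨯ Y)) : Subobject Y :=
  equalizerSubobject ((powerObject X).classify A) ((powerObject X).classify ⊤)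

/-- Existential quantification, as `∀ t ∈ Ω, ((∀ x, ((x, y) ∈ A ⇒ t)) ⇒ t)`. -/
noncomputable def subEx {X Y : C} (A : Subobject (X ⨯ Y)) : Subobject Y :=
  subAll (X := (powerObject (⊤_ C)).pow)
    (subImp
      (subAll (subImp ((Subobject.pullback (prod.map (𝟙 X) prod.snd)).obj A)
        ((Subobject.pullback (prod.snd ≫ prod.fst)).obj truth)))
      ((Subobject.pullback prod.fst).obj truth))

/-- The interpretation of a formula as a subobject of its context. -/
noncomputable def Formula.interp : ∀ {Γ : List C}, Formula Γ → Subobject (ctxObj Γ)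
  | _, .eq s t => equalizerSubobject s.interp t.interp
  | _, .mem W s t => (Subobject.pullback (prod.lift s.interp t.interp)).obj W.mem
  | _, .and φ ψ => φ.interp ⊓ ψ.interp
  | _, .imp φ ψ => subImp φ.interp ψ.interp
  | _, .all _ φ => subAll φ.interp
  | _, .ex _ φ => subEx φ.interp

/-- The subobject `{(x, y) ∈ X × Y | φ x y}` defined by a formula in two variables: its
interpretation, transported along the canonical isomorphism `X ⨯ Y ≅ X ⨯ (Y ⨯ 1)`. -/
noncomputable def Formula.compr₂ {X Y : C} (φ : Formula [X, Y]) : Subobject (X ⨯ Y) :=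
  (Subobject.pullback (Y := X ⨯ (Y ⨯ ⊤_ C))
    (prod.map (𝟙 X) (prod.lift (𝟙 Y) (terminal.from Y)))).obj φ.interp

end Interpretation

/-- The formula, in the variables `q : Q` and `w : 𝒫(H × P)`,
`∀ p, (f p = q ⇒ ∃! x, (x, p) ∈ w)` and `∀ p, ∀ x, ((x, p) ∈ w ⇒ h x = p ∧ f p = q)`.
The variables of the context are listed innermost first. -/
noncomputable def depProdFormula {C : Type u} [Category.{v} C] [HasFiniteLimits C] {P Q H : C}
    (f : P ⟶ Q) (h : H ⟶ P) (W : PowerObject (H ⨯ P)) : Formula [Q, W.pow] :=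
  .and
    (.all P
      -- context `p, q, w`
      (.imp (.eq (.app f (.var .zero)) (.var (.succ .zero)))
        (.exUnique H
          -- context `x, p, q, w`
          (.mem W (.pair (.var .zero) (.var (.succ .zero)))
            (.var (.succ (.succ (.succ .zero))))))))
    (.all P (.all H
      -- context `x, p, q, w`
      (.imp
        (.mem W (.pair (.var .zero) (.var (.succ .zero)))
          (.var (.succ (.succ (.succ .zero)))))
        (.and (.eq (.app h (.var .zero)) (.var (.succ .zero)))
          (.eq (.app f (.var (.succ .zero))) (.var (.succ (.succ .zero))))))))

/-- The subobject `{(q, w) ∈ Q × 𝒫(H × P) | depProdFormula}`, as an object over `Q` through the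
projection to `Q`. -/
noncomputable def depProd {C : Type u} [Category.{v} C] [HasFiniteLimits C] [ElementaryTopos C]
    {P Q H : C} (f : P ⟶ Q) (h : H ⟶ P) (W : PowerObject (H ⨯ P)) : Over Q :=
  Over.mk ((depProdFormula f h W).compr₂.arrow ≫ prod.fst)

end ToposLogic

namespace ToposLogic

attribute [local simp] prod.lift_fst prod.lift_snd prod.lift_fst_assoc prod.lift_snd_assoc
  pullback.lift_fst pullback.lift_snd pullback.lift_fst_assoc pullback.lift_snd_assoc

variable {C : Type u} [Category.{v} C]

/-! ### Subobjects as predicates on generalized elements -/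

/-! A subobject is determined by the generalized elements factoring through it, so each connective
can be given a Kripke–Joyal clause (`subImp_factors`, `subAll_factors`, `subEx_factors`). The clause
for `∃` only tests against subobjects, but under uniqueness the witness lives at the given stage
(`forces_exUnique`).

Thus a `Z`-element `(q, w)` of the defined subobject is a relation `w` that is the graph of a
section of `h` over `Z ×_Q P`, where `Z` lies over `Q` by `q`. Sending `s` to its graph and a
relation to its unique values gives mutually inverse transpositions. Since `IsTranspose` is one
relation with unique existence on both sides, inverses and naturality follow formally; Yoneda then
identifies any right adjoint. -/

theorem subobject_le_iff_factors {Y : C} {A B : Subobject Y} :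
    A ≤ B ↔ ∀ {Z : C} (g : Z ⟶ Y), A.Factors g → B.Factors g :=
  ⟨fun h _ g => Subobject.factors_of_le g h,
    fun h => Subobject.le_of_factors (h _ (Subobject.factors_self A))⟩

theorem subobject_eq_iff_factors {Y : C} {A B : Subobject Y} :
    A = B ↔ ∀ {Z : C} (g : Z ⟶ Y), A.Factors g ↔ B.Factors g :=
  ⟨fun h _ _ => h ▸ Iff.rfl, fun h => le_antisymm (subobject_le_iff_factors.2 fun g => (h g).1)
    (subobject_le_iff_factors.2 fun g => (h g).2)⟩

theorem subobject_eq_top_iff_factors_id {Y : C} {A : Subobject Y} :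
    A = ⊤ ↔ A.Factors (𝟙 Y) := by
  refine ⟨fun h => h ▸ Subobject.top_factors _, fun h => top_le_iff.1 ?_⟩
  refine subobject_le_iff_factors.2 fun g _ => ?_
  simpa using Subobject.factors_of_factors_right g h

variable [HasFiniteLimits C]

theorem prod_forall_factors {X Y Z : C} {p : (Z ⟶ X ⨯ Y) → Prop} :
    (∀ g, p g) ↔ ∀ x y, p (prod.lift x y) := by
  refine ⟨fun h _ _ => h _, fun h g => ?_⟩
  have : g = prod.lift (g ≫ prod.fst) (g ≫ prod.snd) := by ext <;> simp
  rw [this]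
  exact h _ _

namespace PowerObject

variable {X : C} (W : PowerObject X)

theorem pullback_classify {Y : C} (N : Subobject (X ⨯ Y)) :
    (Subobject.pullback (prod.map (𝟙 X) (W.classify N))).obj W.mem = N :=
  (W.existsUnique_classify N).choose_spec.1

theorem mem_factors_lift_comp_classify {Y Z : C} (N : Subobject (X ⨯ Y)) (x : Z ⟶ X)
    (y : Z ⟶ Y) :
    W.mem.Factors (prod.lift x (y ≫ W.classify N)) ↔ N.Factors (prod.lift x y) := by
  conv_rhs => rw [← W.pullback_classify N, pullback_factors_iff]
  simp

/-- Extensionality: generalized elements of a power object with the same members are equal. -/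
theorem hom_ext {Y : C} {w w' : Y ⟶ W.pow}
    (h : ∀ {Z : C} (x : Z ⟶ X) (y : Z ⟶ Y),
      W.mem.Factors (prod.lift x (y ≫ w)) ↔ W.mem.Factors (prod.lift x (y ≫ w'))) : w = w' := by
  refine (W.existsUnique_classify
    -- Both arrows classify the pullback of membership along `w'`.
    ((Subobject.pullback (prod.map (𝟙 X) w')).obj W.mem)).unique ?_ rfl
  refine subobject_eq_iff_factors.2 fun {Z} => prod_forall_factors.2 fun x y => ?_
  simpa [pullback_factors_iff] using h x y

end PowerObject

/-! ### Forcing for the operations on subobjects -/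

section Operations

variable [ElementaryTopos C]

theorem truth_factors_comp_char {Y Z : C} (A : Subobject Y) (g : Z ⟶ Y) :
    truth.Factors (g ≫ char A) ↔ A.Factors g := by
  have : (g ≫ char A) ≫ prod.lift (terminal.from _) (𝟙 _) =
      prod.lift (terminal.from _) (g ≫ char A) := by
    ext
    simp
  rw [truth, pullback_factors_iff, this, char,
    PowerObject.mem_factors_lift_comp_classify, pullback_factors_iff, prod.lift_snd]

theorem hom_ext_truth {Y : C} {s t : Y ⟶ (powerObject (⊤_ C)).pow}
    (h : ∀ {Z : C} (g : Z ⟶ Y), truth.Factors (g ≫ s) ↔ truth.Factors (g ≫ t)) : s = t := by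
  refine PowerObject.hom_ext _ fun x y => ?_
  have key (r : Y ⟶ (powerObject (⊤_ C)).pow) : prod.lift x (y ≫ r) =
      (y ≫ r) ≫ prod.lift (terminal.from _) (𝟙 _) := by
    ext
    simp
  simpa [truth, pullback_factors_iff, key] using h y

/-- Arrows into `Ω` agree when they are true at the same stages, and `A ⊓ B` agrees with `A` exactly
where `A` entails `B`. -/
theorem subImp_factors {Y Z : C} (A B : Subobject Y) (g : Z ⟶ Y) :
    (subImp A B).Factors g ↔
      ∀ {Z' : C} (k : Z' ⟶ Z), A.Factors (k ≫ g) → B.Factors (k ≫ g) := by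
  rw [subImp, equalizerSubobject_factors_iff]
  constructor
  · intro h Z' k hA
    rw [← truth_factors_comp_char, Category.assoc, ← h, ← Category.assoc,
      truth_factors_comp_char, Subobject.inf_factors] at hA
    exact hA.2
  · intro h
    refine hom_ext_truth fun k => ?_
    rw [← Category.assoc, ← Category.assoc, truth_factors_comp_char, truth_factors_comp_char,
      Subobject.inf_factors]
    exact ⟨And.left, fun hA => ⟨hA, h k hA⟩⟩

theorem subAll_factors {X Y Z : C} (A : Subobject (X ⨯ Y)) (g : Z ⟶ Y) :
    (subAll A).Factors g ↔
      ∀ {Z' : C} (k : Z' ⟶ Z) (x : Z' ⟶ X), A.Factors (prod.lift x (k ≫ g)) := by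
  rw [subAll, equalizerSubobject_factors_iff]
  constructor
  · intro h Z' k x
    rw [← (powerObject X).mem_factors_lift_comp_classify, Category.assoc, h, ← Category.assoc,
      PowerObject.mem_factors_lift_comp_classify]
    exact Subobject.top_factors _
  · intro h
    refine PowerObject.hom_ext _ fun x k => ?_
    rw [← Category.assoc, ← Category.assoc, PowerObject.mem_factors_lift_comp_classify,
      PowerObject.mem_factors_lift_comp_classify]
    exact iff_of_true (h k x) (Subobject.top_factors _)

/-- In the second-order encoding, the bound truth value at stage `Z'` amounts to a subobject `S` of
`Z'`: pass from `S` to `char S`, and back by pulling back `truth`. -/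
theorem subEx_factors {X Y Z : C} (A : Subobject (X ⨯ Y)) (g : Z ⟶ Y) :
    (subEx A).Factors g ↔ ∀ {Z' : C} (k : Z' ⟶ Z) (S : Subobject Z'),
      (∀ {Z'' : C} (l : Z'' ⟶ Z') (x : Z'' ⟶ X),
        A.Factors (prod.lift x (l ≫ k ≫ g)) → S.Factors l) → S = ⊤ := by
  simp only [subEx, subAll_factors, subImp_factors, pullback_factors_iff]
  simp only [prod.lift_fst, prod.comp_lift, prod.lift_map, prod.lift_snd, Category.comp_id,
    ← Category.assoc]
  constructor
  · intro h Z' k S hS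
    rw [subobject_eq_top_iff_factors_id, ← truth_factors_comp_char]
    refine h k (char S) (𝟙 _) fun l x _ m hA => ?_
    rw [truth_factors_comp_char]
    refine hS _ (m ≫ x) ?_
    simpa using hA
  · intro h Z' k t Z'' l hl
    have := h (l ≫ k) ((Subobject.pullback (l ≫ t)).obj truth) fun m x hA => by
      rw [pullback_factors_iff]
      simpa using hl m x (𝟙 _) (by simpa using hA)
    rw [subobject_eq_top_iff_factors_id, pullback_factors_iff] at this
    simpa using this

/-- Description: an element that exists and is unique is defined over the given stage. -/
theorem exists_factors_of_subEx_factors {X Y Z : C} {A : Subobject (X ⨯ Y)} {g : Z ⟶ Y}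
    (h : (subEx A).Factors g)
    (huniq : ∀ {Z' : C} (k : Z' ⟶ Z) (x x' : Z' ⟶ X), A.Factors (prod.lift x (k ≫ g)) →
      A.Factors (prod.lift x' (k ≫ g)) → x = x') :
    ∃ x : Z ⟶ X, A.Factors (prod.lift x g) := by
  obtain ⟨B, hB⟩ : ∃ B : Subobject (X ⨯ Z), ∀ {Z' : C} (x : Z' ⟶ X) (k : Z' ⟶ Z),
      B.Factors (prod.lift x k) ↔ A.Factors (prod.lift x (k ≫ g)) :=
    ⟨(Subobject.pullback (prod.map (𝟙 X) g)).obj A, fun x k => by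
      rw [pullback_factors_iff, prod.lift_map, Category.comp_id]⟩
  have factors {Z' : C} (b : Z' ⟶ (B : C)) : A.Factors
      (prod.lift (b ≫ B.arrow ≫ prod.fst) ((b ≫ B.arrow ≫ prod.snd) ≫ g)) := by
    rw [← hB]
    convert Subobject.factors_comp_arrow b
    ext <;> simp
  -- Uniqueness makes the projection from the solutions `B` to `Z` monic, so it may serve as the
  -- test subobject; being `⊤`, it has a section, which is the element sought.
  have : Mono (B.arrow ≫ prod.snd) := by
    refine ⟨fun {Z'} a b hab => ?_⟩
    rw [← cancel_mono B.arrow]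
    ext
    · simpa using huniq _ _ _ (factors a) (hab ▸ factors b)
    · simpa using hab
  have htop := (subEx_factors A g).1 h (𝟙 Z) (Subobject.mk (B.arrow ≫ prod.snd))
    fun {Z'} l x hx => by
      rw [Category.id_comp, ← hB] at hx
      exact ⟨B.factorThru _ hx, by simp⟩
  obtain ⟨s, hs⟩ : ∃ s : Z ⟶ (B : C), _ := subobject_eq_top_iff_factors_id.1 htop
  change s ≫ B.arrow ≫ prod.snd = 𝟙 Z at hs
  exact ⟨s ≫ B.arrow ≫ prod.fst, by simpa [hs] using factors s⟩

end Operations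

/-! ### Forcing for formulas -/

/-- Extension of a generalized element of a context by a value for a further variable. -/
noncomputable def ctxCons {Γ : List C} {X Z : C} (x : Z ⟶ X) (γ : Z ⟶ ctxObj Γ) :
    Z ⟶ ctxObj (X :: Γ) :=
  prod.lift x γ

/-- The generalized element of the empty context. -/
noncomputable def ctxNil (Z : C) : Z ⟶ ctxObj ([] : List C) :=
  terminal.from Z

theorem comp_ctxCons {Γ : List C} {X Z Z' : C} (k : Z' ⟶ Z) (x : Z ⟶ X) (γ : Z ⟶ ctxObj Γ) :
    k ≫ ctxCons x γ = ctxCons (k ≫ x) (k ≫ γ) :=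
  prod.comp_lift _ _ _

@[simp]
theorem ctxCons_interp_zero {Γ : List C} {X Z : C} (x : Z ⟶ X) (γ : Z ⟶ ctxObj Γ) :
    ctxCons x γ ≫ (Var.zero : Var (X :: Γ) X).interp = x :=
  prod.lift_fst _ _

@[simp]
theorem ctxCons_interp_succ {Γ : List C} {X Y Z : C} (x : Z ⟶ Y) (γ : Z ⟶ ctxObj Γ)
    (i : Var Γ X) : ctxCons x γ ≫ (Var.succ i : Var (Y :: Γ) X).interp = γ ≫ i.interp :=
  prod.lift_snd_assoc _ _ _

theorem Term.comp_interp_rename {Γ Δ : List C} (ρ : ∀ X : C, Var Γ X → Var Δ X) {Z : C}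
    {γ : Z ⟶ ctxObj Γ} {δ : Z ⟶ ctxObj Δ}
    (h : ∀ X (i : Var Γ X), γ ≫ i.interp = δ ≫ (ρ X i).interp) {X : C} (t : Term Γ X) :
    δ ≫ (t.rename ρ).interp = γ ≫ t.interp := by
  induction t with
  | var i => exact (h _ i).symm
  | app f t ih => simp only [Term.rename, Term.interp, ← Category.assoc, ih]
  | pair s t ihs iht => simp only [Term.rename, Term.interp, prod.comp_lift, ihs, iht]

theorem ctxCons_interp_liftRenaming {Γ Δ : List C} (ρ : ∀ X : C, Var Γ X → Var Δ X)
    {Z : C} {γ : Z ⟶ ctxObj Γ} {δ : Z ⟶ ctxObj Δ}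
    (h : ∀ X (i : Var Γ X), γ ≫ i.interp = δ ≫ (ρ X i).interp) {Y : C} (y : Z ⟶ Y) (X : C)
    (i : Var (Y :: Γ) X) :
    ctxCons y γ ≫ i.interp = ctxCons y δ ≫ (liftRenaming ρ Y X i).interp := by
  cases i with
  | zero => simp [liftRenaming]
  | succ i => simp [liftRenaming, h]

section Forcing

variable [ElementaryTopos C]

/-- A formula is forced at a generalized element of its context if the element factors through
its interpretation. -/
def Formula.Forces {Γ : List C} {Z : C} (γ : Z ⟶ ctxObj Γ) (φ : Formula Γ) : Prop :=
  φ.interp.Factors γ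

namespace Formula

variable {Γ : List C} {Z : C} (γ : Z ⟶ ctxObj Γ)

theorem Forces.comp {γ : Z ⟶ ctxObj Γ} {φ : Formula Γ} (h : φ.Forces γ) {Z' : C} (k : Z' ⟶ Z) :
    φ.Forces (k ≫ γ) :=
  Subobject.factors_of_factors_right k h

theorem forces_eq {X : C} (s t : Term Γ X) :
    (eq s t).Forces γ ↔ γ ≫ s.interp = γ ≫ t.interp :=
  equalizerSubobject_factors_iff _ _ _

theorem forces_mem {X : C} (W : PowerObject X) (s : Term Γ X) (t : Term Γ W.pow) :
    (mem W s t).Forces γ ↔ W.mem.Factors (prod.lift (γ ≫ s.interp) (γ ≫ t.interp)) := by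
  rw [← prod.comp_lift]
  exact pullback_factors_iff _ _ _

theorem forces_and (φ ψ : Formula Γ) : (and φ ψ).Forces γ ↔ φ.Forces γ ∧ ψ.Forces γ :=
  Subobject.inf_factors _

theorem forces_imp (φ ψ : Formula Γ) :
    (imp φ ψ).Forces γ ↔ ∀ {Z' : C} (k : Z' ⟶ Z), φ.Forces (k ≫ γ) → ψ.Forces (k ≫ γ) :=
  subImp_factors _ _ _

theorem forces_all {X : C} (φ : Formula (X :: Γ)) :
    (all X φ).Forces γ ↔
      ∀ {Z' : C} (k : Z' ⟶ Z) (x : Z' ⟶ X), φ.Forces (ctxCons x (k ≫ γ)) :=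
  subAll_factors _ _

theorem forces_ex {X : C} (φ : Formula (X :: Γ)) :
    (ex X φ).Forces γ ↔ ∀ {Z' : C} (k : Z' ⟶ Z) (S : Subobject Z'),
      (∀ {Z'' : C} (l : Z'' ⟶ Z') (x : Z'' ⟶ X),
        φ.Forces (ctxCons x (l ≫ k ≫ γ)) → S.Factors l) → S = ⊤ :=
  subEx_factors _ _

/-- Substitution of variables for variables does not change what is forced. -/
theorem forces_rename (φ : Formula Γ) {Δ : List C} (ρ : ∀ X : C, Var Γ X → Var Δ X) {Z : C}
    {γ : Z ⟶ ctxObj Γ} {δ : Z ⟶ ctxObj Δ}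
    (h : ∀ X (i : Var Γ X), γ ≫ i.interp = δ ≫ (ρ X i).interp) :
    (φ.rename ρ).Forces δ ↔ φ.Forces γ := by
  -- Implication and quantifiers change the stage, so the agreement hypothesis must be stable under
  -- precomposition.
  have hcomp {Γ Δ : List C} {ρ : ∀ X : C, Var Γ X → Var Δ X} {Z Z' : C} {γ : Z ⟶ ctxObj Γ}
      {δ : Z ⟶ ctxObj Δ} (h : ∀ X (i : Var Γ X), γ ≫ i.interp = δ ≫ (ρ X i).interp)
      (k : Z' ⟶ Z) (X : C) (i : Var Γ X) :
      (k ≫ γ) ≫ i.interp = (k ≫ δ) ≫ (ρ X i).interp := by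
    rw [Category.assoc, h, Category.assoc]
  induction φ generalizing Δ Z with
  | eq s t => simp only [rename, forces_eq, Term.comp_interp_rename ρ h]
  | mem W s t => simp only [rename, forces_mem, Term.comp_interp_rename ρ h]
  | and φ ψ ihφ ihψ => simp only [rename, forces_and, ihφ ρ h, ihψ ρ h]
  | imp φ ψ ihφ ihψ =>
    simp only [rename, forces_imp, ihφ ρ (hcomp h _), ihψ ρ (hcomp h _)]
  | all X φ ih =>
    simp only [rename, forces_all, ih _ (ctxCons_interp_liftRenaming ρ (hcomp h _) _)]
  | ex X φ ih =>
    simp only [rename, forces_ex,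
      ih _ (ctxCons_interp_liftRenaming ρ (hcomp (hcomp h _) _) _)]

theorem forces_rename_succ {X Y : C} (φ : Formula (X :: Γ)) (x : Z ⟶ X) (y : Z ⟶ Y) :
    (φ.rename (liftRenaming (fun _ i => .succ i) X)).Forces (ctxCons x (ctxCons y γ)) ↔
      φ.Forces (ctxCons x γ) :=
  forces_rename _ _ (ctxCons_interp_liftRenaming _ (fun _ _ => by simp) x)

/-- Unique existence is witnessed at the stage where it is forced. -/
theorem forces_exUnique {X : C} (φ : Formula (X :: Γ)) :
    (exUnique X φ).Forces γ ↔ ∃ x : Z ⟶ X, φ.Forces (ctxCons x γ) ∧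
      ∀ {Z' : C} (k : Z' ⟶ Z) (x' : Z' ⟶ X), φ.Forces (ctxCons x' (k ≫ γ)) → x' = k ≫ x := by
  have key {Z' : C} (k : Z' ⟶ Z) (x : Z' ⟶ X) :
      (and φ (all X (imp (φ.rename (liftRenaming (fun _ i => .succ i) X))
        (eq (.var .zero) (.var (.succ .zero)))))).Forces (ctxCons x (k ≫ γ)) ↔
      φ.Forces (ctxCons x (k ≫ γ)) ∧ ∀ {Z'' : C} (l : Z'' ⟶ Z') (x' : Z'' ⟶ X),
        φ.Forces (ctxCons x' (l ≫ k ≫ γ)) → x' = l ≫ x := by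
    rw [forces_and, forces_all]
    refine and_congr_right fun _ => ?_
    simp only [forces_imp, forces_eq, comp_ctxCons, forces_rename_succ, Term.interp,
      ctxCons_interp_zero, ctxCons_interp_succ]
    refine ⟨fun h Z'' l x' hx' => ?_, fun h Z'' l x' Z''' m hx' => ?_⟩
    · simpa using h l x' (𝟙 _) (by simpa using hx')
    · simpa using h (m ≫ l) (m ≫ x') (by simpa using hx')
  constructor
  · intro h
    obtain ⟨x, hx⟩ := exists_factors_of_subEx_factors h fun k x x' hx hx' => by
      simpa using ((key k x').1 hx').2 (𝟙 _) x (by simpa using ((key k x).1 hx).1)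
    exact ⟨x, by simpa using (key (𝟙 Z) x).1 (by rw [Category.id_comp]; exact hx)⟩
  · rw [exUnique, forces_ex]
    rintro ⟨x, hx, huniq⟩ Z' k S hS
    rw [subobject_eq_top_iff_factors_id]
    refine hS (𝟙 _) (k ≫ x) ?_
    rw [Category.id_comp, key]
    refine ⟨by simpa [comp_ctxCons] using hx.comp k, fun l x' hx' => ?_⟩
    simpa using huniq (l ≫ k) x' (by simpa using hx')

end Formula

end Forcing

variable [ElementaryTopos C]

/-! ### The universal property of the dependent product -/

theorem compr₂_factors {X Y Z : C} (φ : Formula [X, Y]) (x : Z ⟶ X) (y : Z ⟶ Y) :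
    φ.compr₂.Factors (prod.lift x y) ↔
      φ.Forces (ctxCons x (ctxCons y (ctxNil Z))) := by
  rw [Formula.compr₂]
  refine (pullback_factors_iff _ _ _).trans ?_
  have : prod.lift x y ≫ prod.map (𝟙 X) (prod.lift (𝟙 Y) (terminal.from Y)) =
      prod.lift x (prod.lift y (terminal.from Z)) := by
    simp only [prod.lift_map, Category.comp_id, prod.comp_lift, terminal.comp_from]
  rw [this]
  rfl

variable {P Q H : C} (f : P ⟶ Q) (h : H ⟶ P) (W : PowerObject (H ⨯ P))

/-- The successive changes of stage from nested `∀` and `⇒` collapse to one: compose them, or take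
identities. -/
theorem depProdFormula_factors {Z : C} (q : Z ⟶ Q) (w : Z ⟶ W.pow) :
    (depProdFormula f h W).compr₂.Factors (prod.lift q w) ↔
      (∀ {Z' : C} (k : Z' ⟶ Z) (p : Z' ⟶ P), p ≫ f = k ≫ q →
        ∃ x : Z' ⟶ H, W.mem.Factors (prod.lift (prod.lift x p) (k ≫ w)) ∧
          ∀ {Z'' : C} (l : Z'' ⟶ Z') (x' : Z'' ⟶ H),
            W.mem.Factors (prod.lift (prod.lift x' (l ≫ p)) (l ≫ k ≫ w)) → x' = l ≫ x) ∧
      ∀ {Z' : C} (k : Z' ⟶ Z) (p : Z' ⟶ P) (x : Z' ⟶ H),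
        W.mem.Factors (prod.lift (prod.lift x p) (k ≫ w)) → x ≫ h = p ∧ p ≫ f = k ≫ q := by
  rw [compr₂_factors, depProdFormula, Formula.forces_and]
  simp only [Formula.forces_all, Formula.forces_imp, Formula.forces_exUnique, Formula.forces_and,
    Formula.forces_eq, Formula.forces_mem, comp_ctxCons, Term.interp, prod.comp_lift,
    ctxCons_interp_zero, ctxCons_interp_succ, ← Category.assoc]
  refine and_congr ⟨fun H Z' k p hp => ?_, fun H Z' k p Z'' l hp => ?_⟩
    ⟨fun H Z' k p x hx => ?_, fun H Z' k p Z'' l x Z''' m hx => ?_⟩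
  · simpa using H k p (𝟙 _) (by simpa using hp)
  · simpa using H (l ≫ k) (l ≫ p) (by simpa using hp)
  · simpa using H k p (𝟙 _) x (𝟙 _) (by simpa using hx)
  · simpa using H (m ≫ l ≫ k) (m ≫ l ≫ p) (m ≫ x) (by simpa using hx)

variable {f h W}

/-- The `𝒫(H × P)`-component of an arrow into the dependent product. -/
noncomputable def depProdGraph {T : Over Q} (m : T ⟶ depProd f h W) : T.left ⟶ W.pow :=
  m.left ≫ (depProdFormula f h W).compr₂.arrow ≫ prod.snd

theorem depProd_left_comp_arrow {T : Over Q} (m : T ⟶ depProd f h W) :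
    m.left ≫ (depProdFormula f h W).compr₂.arrow = prod.lift T.hom (depProdGraph m) := by
  ext
  · simpa [depProd] using Over.w m
  · rw [prod.lift_snd]
    exact Category.assoc _ _ _

theorem depProd_hom_ext {T : Over Q} {m m' : T ⟶ depProd f h W}
    (e : depProdGraph m = depProdGraph m') : m = m' := by
  ext
  refine (cancel_mono (depProdFormula f h W).compr₂.arrow).1 ?_
  exact (depProd_left_comp_arrow m).trans (e ▸ (depProd_left_comp_arrow m').symm)

theorem factors_depProdGraph {T : Over Q} (m : T ⟶ depProd f h W) :
    (depProdFormula f h W).compr₂.Factors (prod.lift T.hom (depProdGraph m)) := by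
  rw [← depProd_left_comp_arrow]
  exact Subobject.factors_comp_arrow _

/-- The arrow into the dependent product with a given `𝒫(H × P)`-component. -/
noncomputable def depProdLift {T : Over Q} (w : T.left ⟶ W.pow)
    (hw : (depProdFormula f h W).compr₂.Factors (prod.lift T.hom w)) : T ⟶ depProd f h W :=
  Over.homMk ((depProdFormula f h W).compr₂.factorThru _ hw) (by simp [depProd])

@[simp]
theorem depProdGraph_depProdLift {T : Over Q} (w : T.left ⟶ W.pow)
    (hw : (depProdFormula f h W).compr₂.Factors (prod.lift T.hom w)) :
    depProdGraph (depProdLift w hw) = w :=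
  (Subobject.factorThru_arrow_assoc _ _ hw _).trans (prod.lift_snd _ _)

/-- `s : f^* T ⟶ h` and `m : T ⟶ ∏_f h` correspond to each other if the component of `m` in
`𝒫(H × P)` is `t ↦ {(x, p) | f p = t ∧ x = s (t, p)}`. -/
def IsTranspose {T : Over Q} (s : (Over.pullback f).obj T ⟶ Over.mk h)
    (m : T ⟶ depProd f h W) : Prop :=
  ∀ {Z : C} (t : Z ⟶ T.left) (p : Z ⟶ P) (x : Z ⟶ H),
    W.mem.Factors (prod.lift (prod.lift x p) (t ≫ depProdGraph m)) ↔
      ∃ e : t ≫ T.hom = p ≫ f, pullback.lift t p e ≫ s.left = x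

/-- The graph of `s` is the mono `i`, classified by `w`; extensionality gives uniqueness, since the
relation prescribes all members. -/
theorem IsTranspose.existsUnique_right {T : Over Q}
    (s : (Over.pullback f).obj T ⟶ Over.mk h) :
    ∃! m : T ⟶ depProd f h W, IsTranspose s m := by
  have hs : s.left ≫ h = pullback.snd T.hom f := Over.w s
  let i : pullback T.hom f ⟶ (H ⨯ P) ⨯ T.left :=
    prod.lift (prod.lift s.left (pullback.snd T.hom f)) (pullback.fst T.hom f)
  have : Mono i := by
    refine ⟨fun a b hab => ?_⟩
    ext
    · simpa [i] using hab =≫ prod.snd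
    · simpa [i] using hab =≫ prod.fst ≫ prod.snd
  let w := W.classify (Subobject.mk i)
  have key {Z : C} (t : Z ⟶ T.left) (p : Z ⟶ P) (x : Z ⟶ H) :
      W.mem.Factors (prod.lift (prod.lift x p) (t ≫ w)) ↔
        ∃ e : t ≫ T.hom = p ≫ f, pullback.lift t p e ≫ s.left = x := by
    rw [PowerObject.mem_factors_lift_comp_classify]
    constructor
    · intro hz
      obtain ⟨z, hz⟩ : ∃ z : Z ⟶ pullback T.hom f, z ≫ i = _ := hz
      have h1 : z ≫ pullback.fst _ _ = t := by simpa [i] using hz =≫ prod.snd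
      have h2 : z ≫ pullback.snd _ _ = p := by simpa [i] using hz =≫ prod.fst ≫ prod.snd
      have h3 : z ≫ s.left = x := by simpa [i] using hz =≫ prod.fst ≫ prod.fst
      subst h1 h2 h3
      refine ⟨by simp [pullback.condition], ?_⟩
      congr 1
      ext <;> simp
    · rintro ⟨e, rfl⟩
      refine ⟨pullback.lift t p e, ?_⟩
      change _ ≫ i = _
      simp [i]
  have hw : (depProdFormula f h W).compr₂.Factors (prod.lift T.hom w) := by
    rw [depProdFormula_factors]
    refine ⟨fun k p hp => ⟨pullback.lift k p hp.symm ≫ s.left, (key _ _ _).2 ⟨_, rfl⟩, ?_⟩,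
      fun k p x hx => ?_⟩
    · intro Z'' l x' hx'
      rw [← Category.assoc, key] at hx'
      obtain ⟨e, rfl⟩ := hx'
      rw [← Category.assoc]
      congr 1
      ext <;> simp
    · obtain ⟨e, rfl⟩ := (key _ _ _).1 hx
      exact ⟨by rw [Category.assoc, hs, pullback.lift_snd], e.symm⟩
  refine ⟨depProdLift w hw, fun t p x => by simpa using key t p x, fun m hm => ?_⟩
  refine depProd_hom_ext (PowerObject.hom_ext _ fun {Z} xp t => ?_)
  rw [depProdGraph_depProdLift]
  revert xp
  refine prod_forall_factors.2 fun x p => ?_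
  rw [hm, key]

/-- The first clause of the formula, at the generic stage `T ×_Q P`, yields the arrow `x`; the
second puts `x` over `P` and confines the members to that fibre product. -/
theorem IsTranspose.existsUnique_left {T : Over Q} (m : T ⟶ depProd f h W) :
    ∃! s : (Over.pullback f).obj T ⟶ Over.mk h, IsTranspose s m := by
  obtain ⟨hex, hmem⟩ := (depProdFormula_factors f h W _ _).1 (factors_depProdGraph m)
  obtain ⟨x, hx, huniq⟩ := hex (pullback.fst T.hom f) (pullback.snd T.hom f)
    pullback.condition.symm
  refine ⟨Over.homMk x (hmem _ _ _ hx).1, fun t p y => ⟨fun hy => ?_, ?_⟩, fun s hs => ?_⟩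
  · have e := (hmem _ _ _ hy).2.symm
    exact ⟨e, (huniq (pullback.lift t p e) y (by simpa using hy)).symm⟩
  · rintro ⟨e, rfl⟩
    simpa using Subobject.factors_of_factors_right (pullback.lift t p e) hx
  · ext
    -- At the generic element, any transpose has its own value as a member.
    have := (hs (pullback.fst T.hom f) (pullback.snd T.hom f) s.left).2
      ⟨pullback.condition, by simp⟩
    simpa using huniq (𝟙 _) s.left (by simpa using this)

theorem IsTranspose.comp {T T' : Over Q} {s : (Over.pullback f).obj T ⟶ Over.mk h}
    {m : T ⟶ depProd f h W} (hsm : IsTranspose s m) (k : T' ⟶ T) :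
    IsTranspose ((Over.pullback f).map k ≫ s) (k ≫ m) := by
  intro Z t p x
  have : t ≫ depProdGraph (k ≫ m) = (t ≫ k.left) ≫ depProdGraph m := by
    simp [depProdGraph]
  rw [this, hsm]
  have hk (e : t ≫ T'.hom = p ≫ f) (e' : (t ≫ k.left) ≫ T.hom = p ≫ f) :
      pullback.lift t p e ≫ ((Over.pullback f).map k ≫ s).left =
        pullback.lift (t ≫ k.left) p e' ≫ s.left := by
    rw [Over.comp_left, ← Category.assoc]
    congr 1
    refine pullback.hom_ext ?_ ?_ <;> simp
  constructor
  · rintro ⟨e, rfl⟩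
    have e' : t ≫ T'.hom = p ≫ f := by rw [← e, Category.assoc, Over.w]
    exact ⟨e', hk e' e⟩
  · rintro ⟨e, rfl⟩
    have e' : (t ≫ k.left) ≫ T.hom = p ≫ f := by rw [← e, Category.assoc, Over.w]
    exact ⟨e', (hk e e').symm⟩

variable (f h W)

/-- Transposition `Hom(f^* T, h) ≃ Hom(T, ∏_f h)`. -/
noncomputable def depProdHomEquiv (T : Over Q) :
    ((Over.pullback f).obj T ⟶ Over.mk h) ≃ (T ⟶ depProd f h W) where
  toFun s := (IsTranspose.existsUnique_right (W := W) s).choose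
  invFun m := (IsTranspose.existsUnique_left m).choose
  left_inv s := (IsTranspose.existsUnique_left _).unique
    (IsTranspose.existsUnique_left _).choose_spec.1
    (IsTranspose.existsUnique_right s).choose_spec.1
  right_inv m := (IsTranspose.existsUnique_right _).unique
    (IsTranspose.existsUnique_right _).choose_spec.1
    (IsTranspose.existsUnique_left m).choose_spec.1

theorem depProdHomEquiv_naturality {T T' : Over Q} (k : T' ⟶ T)
    (s : (Over.pullback f).obj T ⟶ Over.mk h) :
    depProdHomEquiv f h W T' ((Over.pullback f).map k ≫ s) = k ≫ depProdHomEquiv f h W T s :=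
  (IsTranspose.existsUnique_right _).unique (IsTranspose.existsUnique_right _).choose_spec.1
    (IsTranspose.comp (IsTranspose.existsUnique_right s).choose_spec.1 k)

theorem pullback_isLeftAdjoint : (Over.pullback f).IsLeftAdjoint :=
  (Adjunction.adjunctionOfEquivRight
    (fun T X => depProdHomEquiv f X.hom (powerObject (X.left ⨯ P)) T)
    fun _ _ X k s => depProdHomEquiv_naturality f X.hom _ k s).isLeftAdjoint

/-- Every right adjoint of the pullback functor has the dependent product as its value. -/
noncomputable def depProdIso {prodf : Over P ⥤ Over Q} (adj : Over.pullback f ⊣ prodf) :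
    prodf.obj (Over.mk h) ≅ depProd f h W :=
  Yoneda.ext _ _ (fun g => depProdHomEquiv f h W _ ((adj.homEquiv _ _).symm g))
    (fun g => adj.homEquiv _ _ ((depProdHomEquiv f h W _).symm g)) (by simp) (by simp)
    fun k g => by rw [adj.homEquiv_naturality_left_symm, depProdHomEquiv_naturality]

end ToposLogic

theorem mainTheorem4 {C : Type u} [Category.{v} C] [HasFiniteLimits C]
    [ToposLogic.ElementaryTopos C] {P Q H : C} (f : P ⟶ Q) (h : H ⟶ P)
    (W : ToposLogic.PowerObject (H ⨯ P)) :
    (Over.pullback f).IsLeftAdjoint ∧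
      ∀ (prodf : Over P ⥤ Over Q), (Over.pullback f ⊣ prodf) →
        Nonempty (prodf.obj (Over.mk h) ≅ ToposLogic.depProd f h W) :=
  ⟨ToposLogic.pullback_isLeftAdjoint f, fun _ adj => ⟨ToposLogic.depProdIso f h W adj⟩⟩
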